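/- Let $X$ be a real Hilbert space and let $T\colon X\rightrightarrows X$ be a set-valued mapping with graph $\operatorname{gph}T=\{(u,v): v\in T(u)\}$ and domain $\operatorname{dom}T=\{u: T(u)\neq\emptyset\}$. Assume that $\operatorname{dom}T\neq\emptyset$ and that $\operatorname{gph}T$ is closed in the norm topology of $X\times X$. Definitions. - $T$ is *monotone* if $\langle v_1-v_2,u_1-u_2\rangle\ge 0$ for all $(u_1,v_1),(u_2,v_2)\in\operatorname{gph}T$, and *maximal monotone* if in addition $\operatorname{gph}T=\operatorname{gph}S$ for every monotone $S\colon X\rightrightarrows X$ with $\operatorname{gph}T\subset\operatorname{gph}S$. - $T$ is *hypomonotone* if there is $r>0$ such that $\langle v_1-v_2,u_1-u_2\rangle\ge -r\|u_1-u_2\|^2$ for all $(u_1,v_1),(u_2,v_2)\in\operatorname{gph}T$. - $T$ is *semilocally hypomonotone* if for every $\bar u\in\operatorname{dom}T$ there are a neighborhood $U$ of $\bar u$ and a number $r>0$ such that the same inequality holds for all $(u_1,v_1),(u_2,v_2)\in\operatorname{gph}T\cap(U\times X)$. - For $(u,v)\in\operatorname{gph}T$ and $w\in X$, the *regular coderivative*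 $\widehat D^*T(u,v)(w)$ is the set of all $z\in X$ with $$\limsup_{\substack{(u',v')\to(u,v)\\ (u',v')\in\operatorname{gph}T,\ (u',v')\ne(u,v)}}\frac{\langle z,u'-u\rangle-\langle w,v'-v\rangle}{\|(u',v')-(u,v)\|}\le 0$$ (a condition that holds trivially if $(u,v)$ is an isolated point of $\operatorname{gph}T$), and $\widehat D^*T(u,v)(w)=\emptyset$ if $(u,v)\notin\operatorname{gph}T$. - The *mixed limiting coderivative* $D^*_MT(u,v)(w)$ is the set of all $z\in X$ for which there are sequences $(u_k,v_k)\to(u,v)$ and $w_k\to w$ converging in norm, and $z_k\to z$ converging weakly, with $z_k\in\widehat D^*T(u_k,v_k)(w_k)$ for all $k$. Theorem. The following are equivalent: (i) $T$ is maximal monotone; (ii) $T$ is hypomonotone, and for every $(u,v)\in\operatorname{gph}T$ one has $\langle z,w\rangle\ge 0$ whenever $w\in X$ and $z\in D^*_MT(u,v)(w)$. If in addition $\operatorname{dom}T$ is convex, then (i) is also equivalent to (ii) with "hypomonotone" replaced by "semilocally hypomonotone". -/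

import Mathlib

open Filter Topology
open scoped InnerProductSpace

namespace VarAnal

section Subdifferential

variable {E : Type*} [NormedAddCommGroup E] [InnerProductSpace ℝ E]

/-- The regular (Fréchet) subdifferential of an extended-real-valued function `f` at `x`; it is
empty where `f x = ∞`. The lower limit is over points different from `x`. -/
def regularSubdifferential (f : E → EReal) (x : E) : Set E :=
  {v | f x < ⊤ ∧
    0 ≤ liminf (fun u : E => (f u - f x - ((⟪v, u - x⟫_ℝ : ℝ) : EReal)) / ((‖u - x‖ : ℝ) : EReal))
      (𝓝[≠] x)}

open Classical in
/-- The indicator function of a set: `0` on the set and `∞` outside. -/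
noncomputable def indicatorFun (Ω : Set E) (u : E) : EReal :=
  if u ∈ Ω then 0 else ⊤

/-- The regular normal cone to `Ω` at `x` (empty if `x` is not in `Ω`). -/
def regularNormalCone (Ω : Set E) (x : E) : Set E :=
  regularSubdifferential (indicatorFun Ω) x

end Subdifferential

section Mappings

variable {X : Type*}

/-- The domain of a set-valued mapping. -/
def dom (T : X → Set X) : Set X :=
  {u | (T u).Nonempty}

/-- The graph of a set-valued mapping. -/
def gph (T : X → Set X) : Set (X × X) :=
  {p | p.2 ∈ T p.1}

variable [NormedAddCommGroup X] [InnerProductSpace ℝ X]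

/-- The sequential outer limit of `G p` as `p → p₀`, with strong convergence of the
parameters and weak convergence in `X` of the values. -/
def outerLimit {P : Type*} [TopologicalSpace P] (G : P → Set X) (p₀ : P) : Set X :=
  {z | ∃ (p : ℕ → P) (y : ℕ → X), Tendsto p atTop (𝓝 p₀) ∧
    Tendsto (fun k => toWeakSpace ℝ X (y k)) atTop (𝓝 (toWeakSpace ℝ X z)) ∧
    ∀ k, y k ∈ G (p k)}

/-- The regular coderivative of `T` at `(u, v)`: those `z` for which `(z, -w)` is a regular normal
to the graph of `T` at `(u, v)`. Here `X × X` carries its Hilbert space structure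
`WithLp 2 (X × X)`. -/
def regularCoderivative (T : X → Set X) (u v w : X) : Set X :=
  {z | WithLp.toLp 2 (z, -w) ∈
    regularNormalCone {q : WithLp 2 (X × X) | q.ofLp ∈ gph T} (WithLp.toLp 2 (u, v))}

/-- The mixed limiting coderivative of `T` at `(u, v)`: the outer limit of the regular
coderivatives at `(u', v')`, in the direction `w'`, as `(u', v') → (u, v)` and `w' → w` strongly. -/
def mixedCoderivative (T : X → Set X) (u v w : X) : Set X :=
  outerLimit (fun p : (X × X) × X => regularCoderivative T p.1.1 p.1.2 p.2) ((u, v), w)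

/-- Monotonicity of a set-valued mapping. -/
def IsMonotone (T : X → Set X) : Prop :=
  ∀ p₁ ∈ gph T, ∀ p₂ ∈ gph T, 0 ≤ ⟪p₁.2 - p₂.2, p₁.1 - p₂.1⟫_ℝ

/-- Maximal monotonicity of a set-valued mapping. -/
def IsMaximalMonotone (T : X → Set X) : Prop :=
  IsMonotone T ∧ ∀ S : X → Set X, IsMonotone S → gph T ⊆ gph S → gph T = gph S

/-- (Global) hypomonotonicity of a set-valued mapping. -/
def IsHypomonotone (T : X → Set X) : Prop :=
  ∃ r : ℝ, 0 < r ∧ ∀ p₁ ∈ gph T, ∀ p₂ ∈ gph T,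
    -r * ‖p₁.1 - p₂.1‖ ^ 2 ≤ ⟪p₁.2 - p₂.2, p₁.1 - p₂.1⟫_ℝ

/-- Semilocal hypomonotonicity of a set-valued mapping at the point `x`. -/
def IsSemilocallyHypomonotoneAt (T : X → Set X) (x : X) : Prop :=
  ∃ U ∈ 𝓝 x, ∃ r : ℝ, 0 < r ∧
    ∀ p₁ ∈ gph T ∩ U ×ˢ Set.univ, ∀ p₂ ∈ gph T ∩ U ×ˢ Set.univ,
      -r * ‖p₁.1 - p₂.1‖ ^ 2 ≤ ⟪p₁.2 - p₂.2, p₁.1 - p₂.1⟫_ℝ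

/-- Semilocal hypomonotonicity of a set-valued mapping on the whole space, that is, at every point
of its domain. -/
def IsSemilocallyHypomonotone (T : X → Set X) : Prop :=
  ∀ x ∈ dom T, IsSemilocallyHypomonotoneAt T x

/-- Positive semidefiniteness of the mixed limiting coderivative on the graph. -/
def MixedCoderivativePSD (T : X → Set X) : Prop :=
  ∀ u v : X, (u, v) ∈ gph T → ∀ w z : X, z ∈ mixedCoderivative T u v w → 0 ≤ ⟪z, w⟫_ℝ

end Mappings

end VarAnal

/-!
Both directions go through the shifted map `T + s I`, whose inverse turns statements about the graph
of `T` into statements about a Lipschitz map `P`.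

*From the coderivative condition to maximality.* Let `T` be hypomonotone with constant `r` on a
closed ball of radius `c` around `u₁`, let `v₁ ∈ T u₁` and `s > r`. Restricted to this ball, `T + s I`
has a closed range `D` and a single-valued `1 / (s - r)`-Lipschitz inverse `P` on it. A proximal normal
to the graph of `P` at a point of `D` within `(s - r) c` of `y₁ = v₁ + s u₁`, say `(ζ, -w)`, becomes a
regular normal to the graph of `T`, and positive semidefiniteness reads `s ‖ζ‖ ^ 2 ≤ ⟪w, ζ⟫`
(`mul_norm_sq_le_inner_of_proximal_normal`). Two consequences follow.

* With `w = 0` no nonzero vector is proximally normal to `D` near `y₁`. As a closed set in a Hilbert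
  space has proximal normals near every boundary point, `D` contains the ball of radius
  `(s - r) c / 2` around `y₁` (`ball_subset_shifted_range`).
* For general `w`, the proximal subgradients of `y ↦ ⟪w, P y - y / (2 s)⟫` are bounded by
  `‖w‖ / (2 s)`. By a mean value inequality `P - I / (2 s)` is `1 / (2 s)`-Lipschitz around `y₁`, that
  is, `P` is firmly nonexpansive up to scaling, which is monotonicity of `T` for pairs of points whose
  shifts are close (`inner_nonneg_of_shifted_near`).

Since the radius `(s - r) c / 3` grows faster in `s` than `‖(v₂ + s u₂) - (v₁ + s u₁)‖` as soon as
`3 ‖u₂ - u₁‖ < c`, letting `s` be large removes every condition on `v₁` and `v₂`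
(`inner_nonneg_of_hypomonotone_near`). So global hypomonotonicity gives monotonicity, and semilocal
hypomonotonicity gives monotonicity near each point of the domain, which spreads along segments
when the domain is convex. For monotone `T` the first consequence, with `c` large, says that `T + I`
is onto, and maximality follows.

Existence of proximal normals and the mean value inequality both rest on a linear variational
principle of Stegall type, `exists_small_linear_perturbation_attains_min`.

*From maximality to the coderivative condition.* By Minty's theorem `T + I` is onto, so the graph of
`T` can be probed in every direction; the increments obtained lie in balls with diameter `[0, t h]`,
and for a regular coderivative `z` in direction `w` this yields `‖z - w‖ ≤ ‖z + w‖`. The inequality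
`0 ≤ ⟪z, w⟫` passes to mixed limits because weakly convergent sequences are bounded.
-/

/-! ### A linear variational principle -/

/-- Stegall's variational principle in a Hilbert space: a continuous function that is bounded below
on a bounded closed set attains its minimum there after an arbitrarily small linear perturbation.
The perturbations with a sublevel slice of diameter less than `1 / (n + 1)` form a dense open set,
and a perturbation in all these sets makes every minimizing sequence Cauchy. -/
theorem exists_small_linear_perturbation_attains_min {H : Type*} [NormedAddCommGroup H]
    [InnerProductSpace ℝ H] [CompleteSpace H] {D : Set H} {F : H → ℝ} {x₀ : H} {M m : ℝ}
    (hD : IsClosed D) (hne : D.Nonempty) (hM : ∀ d ∈ D, ‖d - x₀‖ ≤ M) (hF : ContinuousOn F D)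
    (hm : ∀ d ∈ D, m ≤ F d) {δ : ℝ} (hδ : 0 < δ) :
    ∃ p : H, ‖p‖ < δ ∧ ∃ y ∈ D, ∀ d ∈ D, F y + ⟪p, y - x₀⟫_ℝ ≤ F d + ⟪p, d - x₀⟫_ℝ := by
  obtain ⟨d₁, hd₁⟩ := hne
  have hM0 : 0 ≤ M := (norm_nonneg _).trans (hM d₁ hd₁)
  have hin : ∀ (p : H), ∀ d ∈ D, |⟪p, d - x₀⟫_ℝ| ≤ ‖p‖ * M := fun p d hd =>
    (abs_real_inner_le_norm _ _).trans (mul_le_mul_of_nonneg_left (hM d hd) (norm_nonneg _))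
  let U : ℕ → Set H := fun n => {p | ∃ t : ℝ, (∃ d ∈ D, F d + ⟪p, d - x₀⟫_ℝ < t) ∧
    ∀ d ∈ D, ∀ d' ∈ D, F d + ⟪p, d - x₀⟫_ℝ < t → F d' + ⟪p, d' - x₀⟫_ℝ < t →
      dist d d' < 1 / ((n : ℝ) + 1)}
  have hopen : ∀ n, IsOpen (U n) := by
    intro n
    rw [Metric.isOpen_iff]
    rintro p ⟨t, ⟨d₀, hd₀, h₀⟩, ht⟩
    set η := (t - (F d₀ + ⟪p, d₀ - x₀⟫_ℝ)) / 2 with hη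
    have hηpos : 0 < η := by rw [hη]; linarith
    refine ⟨η / (M + 1), by positivity, fun p' hp' => ?_⟩
    have key : ∀ d ∈ D, |⟪p', d - x₀⟫_ℝ - ⟪p, d - x₀⟫_ℝ| < η := by
      intro d hd
      rw [← inner_sub_left]
      have h1 := hin (p' - p) d hd
      rw [Metric.mem_ball, dist_eq_norm, lt_div_iff₀ (by positivity)] at hp'
      nlinarith [norm_nonneg (p' - p)]
    refine ⟨t - η, ⟨d₀, hd₀, ?_⟩, fun d hd d' hd' h h' => ht d hd d' hd' ?_ ?_⟩
    · have := abs_lt.1 (key d₀ hd₀); linarith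
    · have := abs_lt.1 (key d hd); linarith
    · have := abs_lt.1 (key d' hd'); linarith
  have hdense : ∀ n, Dense (U n) := by
    intro n
    rw [Metric.dense_iff]
    intro p r hr
    set κ := r / (2 * M + 1) / 2 with hκ
    have hκpos : 0 < κ := by positivity
    set a : ℝ := 1 / ((n : ℝ) + 1) with ha
    have hapos : 0 < a := by positivity
    set ε := κ * a ^ 2 / 16 with hε
    have hεpos : 0 < ε := by positivity
    -- At a near-minimizer `d₀` of the perturbation by `-κ ‖· - x₀‖ ^ 2`, linearizing this quadratic
    -- term leaves growth `κ ‖· - d₀‖ ^ 2`, so that the slice below the value at `d₀` is small.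
    let Φ : D → ℝ := fun d => F d + ⟪p, (d : H) - x₀⟫_ℝ - κ * ‖(d : H) - x₀‖ ^ 2
    have hbdd : BddBelow (Set.range Φ) := by
      refine ⟨m - ‖p‖ * M - κ * M ^ 2, ?_⟩
      rintro _ ⟨⟨d, hd⟩, rfl⟩
      have h1 := hm d hd
      have h2 := (abs_le.1 (hin p d hd)).1
      have h3 : ‖d - x₀‖ ^ 2 ≤ M ^ 2 := pow_le_pow_left₀ (norm_nonneg _) (hM d hd) 2
      have h4 := mul_le_mul_of_nonneg_left h3 hκpos.le
      simp only [Φ]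
      linarith
    have : Nonempty D := ⟨⟨d₁, hd₁⟩⟩
    obtain ⟨⟨d₀, hd₀⟩, h₀⟩ := exists_lt_of_ciInf_lt (lt_add_of_pos_right (⨅ d, Φ d) hεpos)
    have hmin : ∀ d (hd : d ∈ D), Φ ⟨d₀, hd₀⟩ < Φ ⟨d, hd⟩ + ε := fun d hd =>
      h₀.trans_le (add_le_add_left (ciInf_le hbdd ⟨d, hd⟩) ε)
    set q : H := p - (2 * κ) • (d₀ - x₀) with hq
    have hgrow : ∀ d ∈ D, F d₀ + ⟪q, d₀ - x₀⟫_ℝ + κ * ‖d - d₀‖ ^ 2 < F d + ⟪q, d - x₀⟫_ℝ + ε := by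
      intro d hd
      have h1 := hmin d hd
      simp only [Φ] at h1
      have h2 : ‖d - x₀‖ ^ 2 = ‖d - d₀‖ ^ 2 + 2 * ⟪d₀ - x₀, d - x₀⟫_ℝ - ‖d₀ - x₀‖ ^ 2 := by
        have := norm_sub_sq_real (d - x₀) (d₀ - x₀)
        rw [sub_sub_sub_cancel_right, real_inner_comm] at this
        linarith
      rw [hq, inner_sub_left, inner_sub_left, real_inner_smul_left, real_inner_smul_left,
        real_inner_self_eq_norm_sq]
      rw [h2] at h1
      nlinarith
    have hclose : ∀ d ∈ D, F d + ⟪q, d - x₀⟫_ℝ < F d₀ + ⟪q, d₀ - x₀⟫_ℝ + ε → ‖d - d₀‖ < a / 2 := by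
      intro d hd h
      have h1 := hgrow d hd
      have h2 : κ * ‖d - d₀‖ ^ 2 < κ * (a / 2) ^ 2 := by rw [hε] at h1 h; nlinarith
      exact lt_of_pow_lt_pow_left₀ 2 (by positivity) (lt_of_mul_lt_mul_left h2 hκpos.le)
    refine ⟨q, ?_, F d₀ + ⟪q, d₀ - x₀⟫_ℝ + ε, ⟨d₀, hd₀, by linarith⟩, fun d hd d' hd' h h' => ?_⟩
    · rw [Metric.mem_ball, dist_eq_norm, hq, sub_sub_cancel_left, norm_neg, norm_smul,
        Real.norm_of_nonneg (by positivity)]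
      have h1 := hM d₀ hd₀
      calc 2 * κ * ‖d₀ - x₀‖ ≤ 2 * κ * M := by gcongr
        _ = r * (M / (2 * M + 1)) := by rw [hκ]; field_simp
        _ < r * 1 := by
            refine mul_lt_mul_of_pos_left ?_ hr
            rw [div_lt_one (by positivity)]
            linarith
        _ = r := mul_one r
    · have h1 := hclose d hd h
      have h2 := hclose d' hd' h'
      rw [← dist_eq_norm] at h1 h2
      have := dist_triangle_right d d' d₀
      linarith
  obtain ⟨p, hp, hpU⟩ := Metric.dense_iff.1 (dense_iInter_of_isOpen_nat hopen hdense) 0 δ hδ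
  rw [Set.mem_iInter] at hpU
  refine ⟨p, by simpa using hp, ?_⟩
  let Φ : D → ℝ := fun d => F d + ⟪p, (d : H) - x₀⟫_ℝ
  have hbdd : BddBelow (Set.range Φ) := by
    refine ⟨m - ‖p‖ * M, ?_⟩
    rintro _ ⟨⟨d, hd⟩, rfl⟩
    have h1 := hm d hd
    have h2 := (abs_le.1 (hin p d hd)).1
    simp only [Φ]
    linarith
  have : Nonempty D := ⟨⟨d₁, hd₁⟩⟩
  have hcont : Continuous Φ := by
    have := continuousOn_iff_continuous_domRestrict.1 hF
    have h2 : Continuous fun d : D => F d := this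
    exact h2.add (by fun_prop)
  choose d hd using fun k : ℕ => exists_lt_of_ciInf_lt
    (lt_add_of_pos_right (⨅ d, Φ d) (Nat.one_div_pos_of_nat (α := ℝ) (n := k)))
  have hlim : Tendsto (fun k => Φ (d k)) atTop (𝓝 (⨅ d, Φ d)) := by
    refine tendsto_of_tendsto_of_tendsto_of_le_of_le tendsto_const_nhds ?_
      (fun k => ciInf_le hbdd (d k)) (fun k => (hd k).le)
    simpa using tendsto_const_nhds.add (tendsto_one_div_add_atTop_nhds_zero_nat (𝕜 := ℝ))
  have hcauchy : CauchySeq d := by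
    rw [Metric.cauchySeq_iff]
    intro ε hε
    obtain ⟨n, hn⟩ := exists_nat_one_div_lt hε
    obtain ⟨t, ⟨e, he, het⟩, ht⟩ := hpU n
    have hev := hlim.eventually_lt_const ((ciInf_le hbdd ⟨e, he⟩).trans_lt het)
    obtain ⟨N, hN⟩ := eventually_atTop.1 hev
    exact ⟨N, fun i hi j hj => (ht _ (d i).2 _ (d j).2 (hN i hi) (hN j hj)).trans hn⟩
  have : CompleteSpace D := hD.completeSpace_coe
  obtain ⟨y, hy⟩ := cauchySeq_tendsto_of_complete hcauchy
  have hyeq : Φ y = ⨅ d, Φ d := tendsto_nhds_unique ((hcont.tendsto y).comp hy) hlim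
  exact ⟨y, y.2, fun e he => hyeq.le.trans (ciInf_le hbdd ⟨e, he⟩)⟩

/-! ### Proximal subgradients and proximal normals -/

section
variable {X : Type*} [NormedAddCommGroup X] [InnerProductSpace ℝ X]

/-- A quadratic upper bound for the norm away from its kink: unit vectors pointing away from `b` are
proximal supergradients of `‖· - b‖`. -/
theorem norm_sub_le_of_pos_norm {y y' b : X} (h : 0 < ‖y - b‖) :
    ‖y' - b‖ - ‖y - b‖ ≤ ⟪(1 / ‖y - b‖) • (y - b), y' - y⟫_ℝ +
      1 / (2 * ‖y - b‖) * ‖y' - y‖ ^ 2 := by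
  have h1 : ‖y' - b‖ ^ 2 = ‖y - b‖ ^ 2 + 2 * ⟪y - b, y' - y⟫_ℝ + ‖y' - y‖ ^ 2 := by
    rw [← norm_add_sq_real]; congr 2; abel
  rw [real_inner_smul_left]
  set t := ‖y - b‖
  have h2 : 1 / t * ⟪y - b, y' - y⟫_ℝ + 1 / (2 * t) * ‖y' - y‖ ^ 2
      = (‖y' - b‖ ^ 2 - t ^ 2) / (2 * t) := by
    rw [h1]; field_simp; ring
  rw [h2, le_div_iff₀ (by positivity)]
  nlinarith [sq_nonneg (‖y' - b‖ - t)]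

theorem max_zero_sq_le (t t' : ℝ) :
    max 0 t' ^ 2 ≤ max 0 t ^ 2 + 2 * max 0 t * (t' - t) + (t' - t) ^ 2 := by
  rcases max_cases 0 t with ⟨h, h0⟩ | ⟨h, h0⟩ <;> rcases max_cases 0 t' with ⟨h', h0'⟩ | ⟨h', h0'⟩ <;>
    rw [h, h'] <;> nlinarith

/-- A mean value inequality: a function, Lipschitz on a closed ball around `b`, whose proximal
subgradients in the open ball are bounded by `ρ`, has slope at most `ρ` between `b` and the points of
the ball. Otherwise `g` plus the cone `ρ' ‖· - b‖`, for some `ρ' > ρ`, is smaller at `a` than at `b`, and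
a minimizer of it (after a small linear perturbation) away from `b` carries a subgradient of norm greater
than `ρ`. -/
theorem sub_le_mul_norm_of_proximal_subgradient_bound [CompleteSpace X] {g : X → ℝ} {a b : X}
    {R L ρ : ℝ} (hρ : 0 ≤ ρ)
    (hL : ∀ y ∈ Metric.closedBall b R, ∀ y' ∈ Metric.closedBall b R, |g y - g y'| ≤ L * ‖y - y'‖)
    (ha : ‖a - b‖ < R)
    (hsub : ∀ y ∈ Metric.ball b R, ∀ ζ : X, ∀ C δ : ℝ, 0 < δ →
      (∀ y', ‖y' - y‖ < δ → ⟪ζ, y' - y⟫_ℝ ≤ g y' - g y + C * ‖y' - y‖ ^ 2) → ‖ζ‖ ≤ ρ) :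
    g b - g a ≤ ρ * ‖a - b‖ := by
  by_contra! hcon
  have hR : 0 < R := (norm_nonneg _).trans_lt ha
  have hbmem : b ∈ Metric.closedBall b R := Metric.mem_closedBall_self hR.le
  have hamem : a ∈ Metric.closedBall b R := by rw [Metric.mem_closedBall, dist_eq_norm]; exact ha.le
  set t₀ := ‖a - b‖ with ht₀
  have ht₀pos : 0 < t₀ := by
    refine (norm_nonneg _).lt_of_ne fun h => ?_
    rw [← ht₀] at h
    have hab : a = b := sub_eq_zero.1 (norm_eq_zero.1 h.symm)
    rw [hab, ← h] at hcon
    simp at hcon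
  -- a slope strictly between `ρ` and the difference quotient
  obtain ⟨ρ', hρ', hρ'gap⟩ : ∃ ρ', ρ < ρ' ∧ ρ' * t₀ < g b - g a := by
    obtain ⟨ρ', h1, h2⟩ := exists_between ((lt_div_iff₀ ht₀pos).2 hcon)
    exact ⟨ρ', h1, (lt_div_iff₀ ht₀pos).1 h2⟩
  have hL0 : 0 ≤ L := by
    have h1 := (abs_nonneg _).trans (hL a hamem b hbmem)
    exact nonneg_of_mul_nonneg_left h1 ht₀pos
  -- The barrier `K * max 0 (‖· - b‖ - t₀) ^ 2` vanishes at `a` and outweighs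
  -- the variation of `g` on the sphere of radius `R`
  set K := L * R / (R - t₀) ^ 2 with hK
  have hRt : 0 < R - t₀ := sub_pos.2 ha
  have hK0 : 0 ≤ K := by positivity
  have hKR : K * (R - t₀) ^ 2 = L * R := by rw [hK]; field_simp
  let F : X → ℝ := fun y => g y + ρ' * ‖y - b‖ + K * max 0 (‖y - b‖ - t₀) ^ 2
  have hgcont : ContinuousOn g (Metric.closedBall b R) := by
    refine LipschitzOnWith.continuousOn (K := L.toNNReal) (LipschitzOnWith.of_dist_le_mul ?_)
    intro y hy y' hy'
    rw [Real.dist_eq, dist_eq_norm, Real.coe_toNNReal _ hL0]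
    exact hL y hy y' hy'
  have hFcont : ContinuousOn F (Metric.closedBall b R) := by
    refine (hgcont.add ?_).add ?_ <;> exact Continuous.continuousOn (by fun_prop)
  have hlow : ∀ y ∈ Metric.closedBall b R, g b - L * ‖y - b‖ ≤ g y := by
    intro y hy
    have := (abs_le.1 (hL y hy b hbmem)).1
    linarith
  have hbound : ∀ y ∈ Metric.closedBall b R, ‖y - b‖ ≤ R := fun y hy => by
    rwa [Metric.mem_closedBall, dist_eq_norm] at hy
  have hFlow : ∀ y ∈ Metric.closedBall b R, g b - L * R ≤ F y := by
    intro y hy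
    have h1 := hlow y hy
    have h2 := mul_le_mul_of_nonneg_left (hbound y hy) hL0
    have h3 : 0 ≤ ρ' * ‖y - b‖ := mul_nonneg (hρ.trans hρ'.le) (norm_nonneg _)
    have h4 : 0 ≤ K * max 0 (‖y - b‖ - t₀) ^ 2 := by positivity
    simp only [F]
    linarith
  obtain ⟨p, hp, y, hy, hmin⟩ := exists_small_linear_perturbation_attains_min
    Metric.isClosed_closedBall ⟨b, hbmem⟩ hbound hFcont hFlow
    (δ := min (ρ' - ρ) ((g b - g a - ρ' * t₀) / t₀))
    (lt_min (by linarith) (div_pos (by linarith) ht₀pos))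
  obtain ⟨hp1, hp2⟩ := lt_min_iff.1 hp
  rw [lt_div_iff₀ ht₀pos] at hp2
  have hya : F y + ⟪p, y - b⟫_ℝ < g b := by
    refine (hmin a hamem).trans_lt ?_
    have h1 := real_inner_le_norm p (a - b)
    have h2 : F a = g a + ρ' * t₀ := by simp [F, ← ht₀]
    rw [h2]
    linarith
  have hyb : 0 < ‖y - b‖ := by
    refine (norm_nonneg _).lt_of_ne fun h => ?_
    have hyb : y = b := sub_eq_zero.1 (norm_eq_zero.1 h.symm)
    rw [hyb] at hya
    have h2 : F b = g b := by simp [F, ht₀pos.le]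
    simp [h2] at hya
  have hyR : ‖y - b‖ < R := by
    refine (hbound y hy).lt_of_ne fun h => ?_
    have h1 := hlow y hy
    have h2 := (abs_le.1 (abs_real_inner_le_norm p (y - b))).1
    have h3 : F y = g y + ρ' * R + L * R := by
      simp only [F]; rw [h, max_eq_right hRt.le, hKR]
    rw [h] at h1 h2
    rw [h3] at hya
    nlinarith
  set m := max 0 (‖y - b‖ - t₀) with hm
  have hm0 : 0 ≤ m := le_max_left _ _
  set lam := ρ' + 2 * K * m with hlam
  have hlamρ : ρ' ≤ lam := by rw [hlam]; nlinarith [mul_nonneg hK0 hm0]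
  set e : X := (1 / ‖y - b‖) • (y - b) with he
  have henorm : ‖e‖ = 1 := by
    rw [he, norm_smul, Real.norm_of_nonneg (by positivity)]
    field_simp
  have hζ := hsub y (by rwa [Metric.mem_ball, dist_eq_norm]) (-p - lam • e)
    (lam / (2 * ‖y - b‖) + K) (R - ‖y - b‖) (by linarith) ?_
  · have h1 : ‖lam • e‖ ≤ ‖-p - lam • e‖ + ‖p‖ := by
      have := norm_sub_le (-p - lam • e) (-p)
      rwa [sub_sub_cancel_left, norm_neg, norm_neg] at this
    rw [norm_smul, henorm, mul_one, Real.norm_of_nonneg (by linarith)] at h1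
    linarith
  · intro y' hy'
    have hy'R : y' ∈ Metric.closedBall b R := by
      rw [Metric.mem_closedBall, dist_eq_norm]
      have := norm_add_le (y' - y) (y - b)
      rw [sub_add_sub_cancel] at this
      linarith
    have h1 := hmin y' hy'R
    have h2 := max_zero_sq_le (‖y - b‖ - t₀) (‖y' - b‖ - t₀)
    rw [← hm, sub_sub_sub_cancel_right] at h2
    have h3 := norm_sub_le_of_pos_norm (y' := y') hyb
    rw [← he] at h3
    have h4 : (‖y' - b‖ - ‖y - b‖) ^ 2 ≤ ‖y' - y‖ ^ 2 := by
      rw [← sq_abs]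
      have := abs_norm_sub_norm_le (y' - b) (y - b)
      rw [sub_sub_sub_cancel_right] at this
      gcongr
    have h5 : ⟪p, y' - b⟫_ℝ = ⟪p, y - b⟫_ℝ + ⟪p, y' - y⟫_ℝ := by
      rw [← inner_add_right]; congr 1; abel
    have h6 := mul_le_mul_of_nonneg_left h3 (show 0 ≤ lam by linarith)
    have h7 := mul_le_mul_of_nonneg_left h2 hK0
    have h8 := mul_le_mul_of_nonneg_left h4 hK0
    have h9 : lam * (1 / (2 * ‖y - b‖) * ‖y' - y‖ ^ 2) =
        lam / (2 * ‖y - b‖) * ‖y' - y‖ ^ 2 := by ring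
    simp only [F] at h1
    rw [inner_sub_left, inner_neg_left, real_inner_smul_left]
    rw [hlam] at h6 ⊢
    rw [hlam] at h9
    linarith

/-- A closed set without nonzero proximal normals at its points near `y₁ ∈ D` contains a ball around
`y₁`: a perturbed nearest point to some `y₀ ∉ D` would carry a nonzero proximal normal. -/
theorem ball_subset_of_proximal_normal_eq_zero [CompleteSpace X] {D : Set X} {y₁ : X} {R : ℝ}
    (hD : IsClosed D) (hy₁ : y₁ ∈ D)
    (hnor : ∀ y ∈ D ∩ Metric.ball y₁ R, ∀ ζ : X, ∀ C δ : ℝ, 0 < δ →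
      (∀ y' ∈ D, ‖y' - y‖ < δ → ⟪ζ, y' - y⟫_ℝ ≤ C * ‖y' - y‖ ^ 2) → ζ = 0) :
    Metric.ball y₁ (R / 2) ⊆ D := by
  intro y₀ hy₀
  by_contra hcon
  rw [Metric.mem_ball, dist_comm, dist_eq_norm] at hy₀
  obtain ⟨r, hr, hrD⟩ := Metric.isOpen_iff.1 hD.isOpen_compl y₀ hcon
  have hfar : ∀ d ∈ D, r ≤ ‖d - y₀‖ := by
    intro d hd
    by_contra! h
    exact hrD (by rwa [Metric.mem_ball, dist_eq_norm]) hd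
  set ρ := ‖y₁ - y₀‖ with hρ
  have hρ0 : 0 ≤ ρ := norm_nonneg _
  have hbound : ∀ y ∈ D ∩ Metric.closedBall y₀ (ρ + 1), ‖y - y₀‖ ≤ ρ + 1 := fun y hy => by
    have := hy.2
    rwa [Metric.mem_closedBall, dist_eq_norm] at this
  have hy₁mem : y₁ ∈ D ∩ Metric.closedBall y₀ (ρ + 1) := by
    refine ⟨hy₁, ?_⟩
    rw [Metric.mem_closedBall, dist_eq_norm]; linarith
  obtain ⟨p, hp, y, hy, hmin⟩ := exists_small_linear_perturbation_attains_min
    (F := fun y => ‖y - y₀‖ ^ 2) (m := 0) (hD.inter Metric.isClosed_closedBall) ⟨y₁, hy₁mem⟩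
    hbound (Continuous.continuousOn (by fun_prop)) (fun _ _ => by positivity)
    (δ := min 1 (min r (R - 2 * ρ))) (lt_min one_pos (lt_min hr (by linarith)))
  obtain ⟨hp1, hp2⟩ := lt_min_iff.1 hp
  obtain ⟨hp2, hp3⟩ := lt_min_iff.1 hp2
  -- the minimizer lies well inside the ball to which `D` was cut down
  have hyle : ‖y - y₀‖ ≤ ρ + ‖p‖ := by
    have h1 := hmin y₁ hy₁mem
    have h2 := (abs_le.1 (abs_real_inner_le_norm p (y - y₀))).1
    have h3 := real_inner_le_norm p (y₁ - y₀)
    simp only [← hρ] at h1 h3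
    by_contra! h
    nlinarith [norm_nonneg p, norm_nonneg (y - y₀)]
  have hzero := hnor y ⟨hy.1, ?_⟩ (-p - (2 : ℝ) • (y - y₀)) 1 (1 - ‖p‖) (by linarith) ?_
  · have h1 : p = -((2 : ℝ) • (y - y₀)) := by
      rw [sub_eq_zero] at hzero
      rw [← hzero, neg_neg]
    have h2 : ‖p‖ = 2 * ‖y - y₀‖ := by
      rw [h1, norm_neg, norm_smul]; norm_num
    have := hfar y hy.1
    linarith
  · rw [Metric.mem_ball, dist_eq_norm]
    have := norm_sub_le (y - y₀) (y₁ - y₀)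
    rw [sub_sub_sub_cancel_right, ← hρ] at this
    linarith
  · intro y' hy' hlt
    have hy'mem : y' ∈ D ∩ Metric.closedBall y₀ (ρ + 1) := by
      refine ⟨hy', ?_⟩
      rw [Metric.mem_closedBall, dist_eq_norm]
      have := norm_add_le (y' - y) (y - y₀)
      rw [sub_add_sub_cancel] at this
      linarith
    have h1 := hmin y' hy'mem
    have h2 : ‖y' - y₀‖ ^ 2 = ‖y - y₀‖ ^ 2 + 2 * ⟪y - y₀, y' - y⟫_ℝ + ‖y' - y‖ ^ 2 := by
      rw [← norm_add_sq_real]; congr 2; abel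
    have h5 : ⟪p, y' - y₀⟫_ℝ = ⟪p, y - y₀⟫_ℝ + ⟪p, y' - y⟫_ℝ := by
      rw [← inner_add_right]; congr 1; abel
    rw [inner_sub_left, inner_neg_left, real_inner_smul_left]
    linarith
end

/-! ### Regular coderivatives in terms of inequalities -/

section
variable {E : Type*} [NormedAddCommGroup E] [InnerProductSpace ℝ E]

theorem mem_regularNormalCone_iff {Ω : Set E} {x n : E} :
    n ∈ VarAnal.regularNormalCone Ω x ↔ x ∈ Ω ∧
      ∀ ε > 0, ∀ᶠ y in 𝓝[≠] x, y ∈ Ω → ⟪n, y - x⟫_ℝ ≤ ε * ‖y - x‖ := by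
  simp only [VarAnal.regularNormalCone, VarAnal.regularSubdifferential, Set.mem_ofPred_eq]
  by_cases hx : x ∈ Ω
  swap
  · simp [VarAnal.indicatorFun, hx]
  have hfx : VarAnal.indicatorFun Ω x = 0 := by simp [VarAnal.indicatorFun, hx]
  have hq : ∀ y ∈ Ω, (VarAnal.indicatorFun Ω y - VarAnal.indicatorFun Ω x -
      ((⟪n, y - x⟫_ℝ : ℝ) : EReal)) / ((‖y - x‖ : ℝ) : EReal) =
      ((-⟪n, y - x⟫_ℝ / ‖y - x‖ : ℝ) : EReal) := by
    intro y hy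
    have hfy : VarAnal.indicatorFun Ω y = 0 := by simp [VarAnal.indicatorFun, hy]
    rw [hfx, hfy, sub_zero, zero_sub, EReal.coe_div, EReal.coe_neg]
  rw [hfx]
  simp only [hx, true_and, EReal.zero_lt_top]
  rw [hfx] at hq
  constructor
  · intro h ε hε
    have h1 := eventually_lt_of_lt_liminf
      ((show ((-ε : ℝ) : EReal) < 0 by exact_mod_cast neg_lt_zero.2 hε).trans_le h)
    filter_upwards [h1, self_mem_nhdsWithin] with y hy hyx hyΩ
    have hpos : 0 < ‖y - x‖ := norm_pos_iff.2 (sub_ne_zero.2 hyx)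
    rw [hq y hyΩ, EReal.coe_lt_coe_iff, lt_div_iff₀ hpos] at hy
    linarith
  · intro h
    refine le_of_forall_lt fun c hc => ?_
    obtain ⟨b, hcb, hb0⟩ := EReal.lt_iff_exists_real_btwn.1 hc
    refine hcb.trans_le (le_liminf_of_le (by isBoundedDefault) ?_)
    have hb : b < 0 := by exact_mod_cast hb0
    filter_upwards [h (-b) (by linarith), self_mem_nhdsWithin] with y hy hyx
    have hpos : 0 < ‖y - x‖ := norm_pos_iff.2 (sub_ne_zero.2 hyx)
    by_cases hyΩ : y ∈ Ω
    · rw [hq y hyΩ, EReal.coe_le_coe_iff, le_div_iff₀ hpos]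
      linarith [hy hyΩ]
    · have hfy : VarAnal.indicatorFun Ω y = ⊤ := by simp [VarAnal.indicatorFun, hyΩ]
      rw [hfy, sub_zero, EReal.top_sub_coe, EReal.top_div_of_pos_ne_top (by exact_mod_cast hpos)
        (EReal.coe_ne_top _)]
      exact le_top

variable {T : E → Set E} {u v w z : E}

theorem mem_regularCoderivative_iff :
    z ∈ VarAnal.regularCoderivative T u v w ↔ v ∈ T u ∧
      ∀ ε > 0, ∃ δ > 0, ∀ u' v', v' ∈ T u' → ‖u' - u‖ < δ → ‖v' - v‖ < δ →
        ⟪z, u' - u⟫_ℝ - ⟪w, v' - v⟫_ℝ ≤ ε * (‖u' - u‖ + ‖v' - v‖) := by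
  rw [VarAnal.regularCoderivative, Set.mem_ofPred_eq, mem_regularNormalCone_iff]
  refine and_congr Iff.rfl ?_
  have hin : ∀ u' v' : E, ⟪(WithLp.toLp 2 (z, -w) : WithLp 2 (E × E)),
      WithLp.toLp 2 (u', v') - WithLp.toLp 2 (u, v)⟫_ℝ = ⟪z, u' - u⟫_ℝ - ⟪w, v' - v⟫_ℝ := by
    intro u' v'
    rw [WithLp.prod_inner_apply]
    simp [inner_neg_left, sub_eq_add_neg]
  have hnorm : ∀ u' v' : E, ‖(WithLp.toLp 2 (u', v') : WithLp 2 (E × E)) - WithLp.toLp 2 (u, v)‖ ^ 2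
      = ‖u' - u‖ ^ 2 + ‖v' - v‖ ^ 2 := by
    intro u' v'
    rw [WithLp.prod_norm_sq_eq_of_L2]
    simp
  have hle : ∀ u' v' : E, ‖(WithLp.toLp 2 (u', v') : WithLp 2 (E × E)) - WithLp.toLp 2 (u, v)‖
      ≤ ‖u' - u‖ + ‖v' - v‖ := fun u' v' => by
    refine le_of_sq_le_sq ?_ (by positivity)
    rw [hnorm]
    nlinarith [norm_nonneg (u' - u), norm_nonneg (v' - v)]
  have hge : ∀ u' v' : E, ‖u' - u‖ + ‖v' - v‖ ≤
      2 * ‖(WithLp.toLp 2 (u', v') : WithLp 2 (E × E)) - WithLp.toLp 2 (u, v)‖ := fun u' v' => by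
    refine le_of_sq_le_sq ?_ (by positivity)
    rw [mul_pow, hnorm]
    nlinarith [sq_nonneg (‖u' - u‖ - ‖v' - v‖), sq_nonneg (‖u' - u‖), sq_nonneg (‖v' - v‖)]
  constructor
  · intro h ε hε
    have h1 := h ε hε
    rw [eventually_nhdsWithin_iff, Metric.eventually_nhds_iff] at h1
    obtain ⟨δ, hδ, h2⟩ := h1
    refine ⟨δ / 2, by positivity, fun u' v' hT hu hv => ?_⟩
    by_cases heq : (WithLp.toLp 2 (u', v') : WithLp 2 (E × E)) = WithLp.toLp 2 (u, v)
    · rw [← hin, heq, sub_self, inner_zero_right]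
      positivity
    · have h3 := h2 (y := WithLp.toLp 2 (u', v'))
        (by rw [dist_eq_norm]; have := hle u' v'; linarith) heq hT
      rw [hin] at h3
      exact h3.trans (mul_le_mul_of_nonneg_left (hle u' v') hε.le)
  · intro h ε hε
    obtain ⟨δ, hδ, h1⟩ := h (ε / 2) (by positivity)
    rw [eventually_nhdsWithin_iff, Metric.eventually_nhds_iff]
    refine ⟨δ / 2, by positivity, fun q hq _ hqT => ?_⟩
    obtain ⟨⟨u', v'⟩⟩ := q
    rw [dist_eq_norm] at hq
    have h2 := hge u' v'
    have h3 := norm_nonneg (u' - u)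
    have h4 := norm_nonneg (v' - v)
    rw [hin]
    refine (h1 u' v' hqT (by linarith) (by linarith)).trans ?_
    nlinarith

theorem regularCoderivative_subset_mixedCoderivative :
    VarAnal.regularCoderivative T u v w ⊆ VarAnal.mixedCoderivative T u v w := fun z hz =>
  ⟨fun _ => ((u, v), w), fun _ => z, tendsto_const_nhds, tendsto_const_nhds, fun _ => hz⟩

/-- Proximal normals are regular normals: an error quadratic in the distance is admissible. -/
theorem mem_regularCoderivative_of_proximal {C δ : ℝ} (huv : v ∈ T u) (hδ : 0 < δ)
    (h : ∀ u' v', v' ∈ T u' → ‖u' - u‖ < δ → ‖v' - v‖ < δ →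
      ⟪z, u' - u⟫_ℝ - ⟪w, v' - v⟫_ℝ ≤ C * (‖u' - u‖ + ‖v' - v‖) ^ 2) :
    z ∈ VarAnal.regularCoderivative T u v w := by
  refine mem_regularCoderivative_iff.2 ⟨huv, fun ε hε => ?_⟩
  refine ⟨min δ (ε / (2 * (|C| + 1))), by positivity, fun u' v' hT hu hv => ?_⟩
  obtain ⟨hu1, hu2⟩ := lt_min_iff.1 hu
  obtain ⟨hv1, hv2⟩ := lt_min_iff.1 hv
  refine (h u' v' hT hu1 hv1).trans ?_
  rw [sq, ← mul_assoc]
  refine mul_le_mul_of_nonneg_right ?_ (by positivity)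
  rw [lt_div_iff₀ (by positivity)] at hu2 hv2
  have := le_abs_self C
  nlinarith [norm_nonneg (u' - u), norm_nonneg (v' - v), abs_nonneg C]

end

/-! ### The range and the inverse of the shifted map -/

section
variable {X : Type*} [NormedAddCommGroup X] [InnerProductSpace ℝ X] {T : X → Set X}

/-- The range of `T + s I`, restricted to a closed ball around `u₁`, is closed if this restriction is
expanding. -/
theorem isClosed_shifted_range [CompleteSpace X] (hT : IsClosed (VarAnal.gph T)) {u₁ : X} {c s κ : ℝ}
    (hκ : 0 < κ)
    (hexp : ∀ u v u' v', ‖u - u₁‖ ≤ c → ‖u' - u₁‖ ≤ c → v ∈ T u → v' ∈ T u' →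
      κ * ‖u - u'‖ ≤ ‖(v + s • u) - (v' + s • u')‖) :
    IsClosed {y : X | ∃ u, ‖u - u₁‖ ≤ c ∧ y - s • u ∈ T u} := by
  refine IsSeqClosed.isClosed fun y y₀ hy hlim => ?_
  choose u huc huT using hy
  have hcau : CauchySeq u := by
    rw [Metric.cauchySeq_iff]
    intro ε hε
    obtain ⟨N, hN⟩ := Metric.cauchySeq_iff.1 hlim.cauchySeq (κ * ε) (by positivity)
    refine ⟨N, fun m hm n hn => ?_⟩
    have h1 := hexp _ _ _ _ (huc m) (huc n) (huT m) (huT n)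
    rw [sub_add_cancel, sub_add_cancel, ← dist_eq_norm, ← dist_eq_norm] at h1
    exact lt_of_mul_lt_mul_left (h1.trans_lt (hN m hm n hn)) hκ.le
  obtain ⟨u₀, hu₀⟩ := cauchySeq_tendsto_of_complete hcau
  refine ⟨u₀, le_of_tendsto ((hu₀.sub_const u₁).norm) (Eventually.of_forall huc), ?_⟩
  have h2 : Tendsto (fun n => (u n, y n - s • u n)) atTop (𝓝 (u₀, y₀ - s • u₀)) :=
    hu₀.prodMk_nhds (hlim.sub (hu₀.const_smul s))
  exact hT.mem_of_tendsto h2 (Eventually.of_forall huT)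

theorem mul_norm_sub_le_of_hypomonotone {u v u' v' : X} {r s : ℝ}
    (h : -r * ‖u - u'‖ ^ 2 ≤ ⟪v - v', u - u'⟫_ℝ) :
    (s - r) * ‖u - u'‖ ≤ ‖(v + s • u) - (v' + s • u')‖ := by
  have h1 : ⟪(v + s • u) - (v' + s • u'), u - u'⟫_ℝ = ⟪v - v', u - u'⟫_ℝ + s * ‖u - u'‖ ^ 2 := by
    rw [← real_inner_self_eq_norm_sq, ← real_inner_smul_left, ← inner_add_left]
    congr 1; module
  have h2 := real_inner_le_norm ((v + s • u) - (v' + s • u')) (u - u')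
  rcases (norm_nonneg (u - u')).eq_or_lt with h0 | h0
  · rw [← h0]; simp
  · refine le_of_mul_le_mul_right ?_ h0
    rw [h1] at h2
    nlinarith

/-- Positive semidefiniteness in the coordinates of the inverse of `T + s I`: if `(ζ, -w)` is a proximal
normal to the graph of this inverse, then `s • ζ - w` is in the regular coderivative of `T` in direction
`-ζ`. -/
theorem mul_norm_sq_le_inner_of_proximal_normal (hpsd : VarAnal.MixedCoderivativePSD T)
    {u₁ u v ζ w : X} {c s C δ : ℝ} (hs : 0 < s) (huv : v ∈ T u) (huc : ‖u - u₁‖ < c) (hδ : 0 < δ)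
    (h : ∀ u' v', v' ∈ T u' → ‖u' - u₁‖ ≤ c → ‖(v' + s • u') - (v + s • u)‖ < δ →
      ⟪ζ, (v' + s • u') - (v + s • u)⟫_ℝ - ⟪w, u' - u⟫_ℝ ≤
        C * ‖(v' + s • u') - (v + s • u)‖ ^ 2) :
    s * ‖ζ‖ ^ 2 ≤ ⟪w, ζ⟫_ℝ := by
  have hmem : s • ζ - w ∈ VarAnal.regularCoderivative T u v (-ζ) := by
    refine mem_regularCoderivative_of_proximal (C := |C| * (1 + s) ^ 2)
      (δ := min (c - ‖u - u₁‖) (δ / (1 + s))) huv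
      (lt_min (by linarith) (by positivity)) fun u' v' hT hu hv => ?_
    obtain ⟨hu1, hu2⟩ := lt_min_iff.1 hu
    obtain ⟨hv1, hv2⟩ := lt_min_iff.1 hv
    have heq : (v' + s • u') - (v + s • u) = (v' - v) + s • (u' - u) := by module
    have hle : ‖(v' + s • u') - (v + s • u)‖ ≤ ‖v' - v‖ + s * ‖u' - u‖ := by
      rw [heq]
      refine (norm_add_le _ _).trans ?_
      rw [norm_smul, Real.norm_of_nonneg hs.le]
    rw [lt_div_iff₀ (by positivity)] at hu2 hv2
    have h0 := norm_nonneg (u' - u)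
    have h0' := norm_nonneg (v' - v)
    have h1 := h u' v' hT ?_ ?_
    · have h2 : ⟪s • ζ - w, u' - u⟫_ℝ - ⟪-ζ, v' - v⟫_ℝ =
          ⟪ζ, (v' + s • u') - (v + s • u)⟫_ℝ - ⟪w, u' - u⟫_ℝ := by
        rw [heq, inner_sub_left, real_inner_smul_left, inner_neg_left, inner_add_right,
          real_inner_smul_right]
        ring
      rw [h2]
      refine h1.trans ?_
      rw [mul_assoc, ← mul_pow]
      refine (mul_le_mul_of_nonneg_right (le_abs_self C) (by positivity)).trans ?_
      refine mul_le_mul_of_nonneg_left ?_ (abs_nonneg C)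
      refine pow_le_pow_left₀ (norm_nonneg _) (hle.trans ?_) 2
      nlinarith
    · have := norm_add_le (u' - u) (u - u₁)
      rw [sub_add_sub_cancel] at this
      linarith
    · refine hle.trans_lt ?_
      have : (‖v' - v‖ + s * ‖u' - u‖) * (1 + s) < δ * (1 + s) := by nlinarith
      exact lt_of_mul_lt_mul_right this (by positivity)
  have h1 := hpsd u v huv _ _ (regularCoderivative_subset_mixedCoderivative hmem)
  rw [inner_neg_right, inner_sub_left, real_inner_smul_left, real_inner_self_eq_norm_sq] at h1
  linarith

variable [CompleteSpace X] {u₁ v₁ : X} {c r s : ℝ}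

/-- Near `v₁ + s • u₁` the equation `y ∈ (T + s I) u` is solvable, with `u` in the ball on which `T` is
hypomonotone. -/
theorem ball_subset_shifted_range (hT : IsClosed (VarAnal.gph T))
    (hpsd : VarAnal.MixedCoderivativePSD T) (hs : 0 < s) (hrs : r < s) (hc : 0 < c)
    (h₁ : v₁ ∈ T u₁)
    (hhyp : ∀ u v u' v', ‖u - u₁‖ ≤ c → ‖u' - u₁‖ ≤ c → v ∈ T u → v' ∈ T u' →
      -r * ‖u - u'‖ ^ 2 ≤ ⟪v - v', u - u'⟫_ℝ) :
    Metric.ball (v₁ + s • u₁) ((s - r) * c / 2) ⊆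
      {y : X | ∃ u, ‖u - u₁‖ ≤ c ∧ y - s • u ∈ T u} := by
  have hκ : 0 < s - r := sub_pos.2 hrs
  have hexp : ∀ u v u' v', ‖u - u₁‖ ≤ c → ‖u' - u₁‖ ≤ c → v ∈ T u → v' ∈ T u' →
      (s - r) * ‖u - u'‖ ≤ ‖(v + s • u) - (v' + s • u')‖ := fun u v u' v' hu hu' hv hv' =>
    mul_norm_sub_le_of_hypomonotone (hhyp u v u' v' hu hu' hv hv')
  have hc₁ : ‖u₁ - u₁‖ ≤ c := by simpa using hc.le
  refine ball_subset_of_proximal_normal_eq_zero (isClosed_shifted_range hT hκ hexp)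
    ⟨u₁, hc₁, by rwa [add_sub_cancel_right]⟩ ?_
  rintro y ⟨⟨u, hu, huT⟩, hy⟩ ζ C δ hδ h
  have huc : ‖u - u₁‖ < c := by
    have h1 := hexp _ _ _ _ hu hc₁ huT h₁
    rw [sub_add_cancel] at h1
    rw [Metric.mem_ball, dist_eq_norm] at hy
    exact lt_of_mul_lt_mul_left (h1.trans_lt hy) hκ.le
  have h1 := mul_norm_sq_le_inner_of_proximal_normal (ζ := ζ) (w := 0) (C := C) hpsd hs huT huc hδ ?_
  · rw [inner_zero_left] at h1
    have : ‖ζ‖ ^ 2 ≤ 0 := by nlinarith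
    simpa using this
  · intro u' v' hT' hu' hlt
    rw [sub_add_cancel] at hlt ⊢
    rw [inner_zero_left, sub_zero]
    exact h _ ⟨u', hu', by rwa [add_sub_cancel_right]⟩ hlt

/-- Monotonicity of `T` for pairs of graph points whose shifts by `s I` are close, proved as firm
nonexpansiveness of the inverse of `T + s I`. -/
theorem inner_nonneg_of_shifted_near (hT : IsClosed (VarAnal.gph T))
    (hpsd : VarAnal.MixedCoderivativePSD T) (hs : 0 < s) (hrs : r < s) (hc : 0 < c)
    (h₁ : v₁ ∈ T u₁)
    (hhyp : ∀ u v u' v', ‖u - u₁‖ ≤ c → ‖u' - u₁‖ ≤ c → v ∈ T u → v' ∈ T u' →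
      -r * ‖u - u'‖ ^ 2 ≤ ⟪v - v', u - u'⟫_ℝ)
    {u₂ v₂ : X} (h₂ : v₂ ∈ T u₂) (hu₂ : ‖u₂ - u₁‖ ≤ c)
    (hy₂ : ‖(v₂ + s • u₂) - (v₁ + s • u₁)‖ < (s - r) * c / 3) :
    0 ≤ ⟪v₂ - v₁, u₂ - u₁⟫_ℝ := by
  have hκ : 0 < s - r := sub_pos.2 hrs
  have hexp : ∀ u v u' v', ‖u - u₁‖ ≤ c → ‖u' - u₁‖ ≤ c → v ∈ T u → v' ∈ T u' →
      (s - r) * ‖u - u'‖ ≤ ‖(v + s • u) - (v' + s • u')‖ := fun u v u' v' hu hu' hv hv' =>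
    mul_norm_sub_le_of_hypomonotone (hhyp u v u' v' hu hu' hv hv')
  have hc₁ : ‖u₁ - u₁‖ ≤ c := by simpa using hc.le
  set y₁ := v₁ + s • u₁ with hy₁
  set y₂ := v₂ + s • u₂ with hy₂def
  have hfull := ball_subset_shifted_range hT hpsd hs hrs hc h₁ hhyp
  rw [← hy₁] at hfull
  have hexP : ∀ y, ∃ u, y ∈ Metric.ball y₁ ((s - r) * c / 2) → ‖u - u₁‖ ≤ c ∧ y - s • u ∈ T u := by
    intro y
    by_cases hy : y ∈ Metric.ball y₁ ((s - r) * c / 2)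
    · obtain ⟨u, hu⟩ := hfull hy
      exact ⟨u, fun _ => hu⟩
    · exact ⟨0, fun h => absurd h hy⟩
  choose P hP using hexP
  have hRpos : 0 < (s - r) * c := by positivity
  have hsub : Metric.closedBall y₁ ((s - r) * c / 3) ⊆ Metric.ball y₁ ((s - r) * c / 2) :=
    Metric.closedBall_subset_ball (by linarith)
  have hPeq : ∀ u v, ‖u - u₁‖ ≤ c → v ∈ T u → v + s • u ∈ Metric.ball y₁ ((s - r) * c / 2) →
      P (v + s • u) = u := by
    intro u v hu hv hmem
    have h1 := hexp _ _ _ _ (hP _ hmem).1 hu (hP _ hmem).2 hv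
    rw [sub_add_cancel, sub_self, norm_zero] at h1
    have h2 : ‖P (v + s • u) - u‖ ≤ 0 := by nlinarith
    exact sub_eq_zero.1 (norm_le_zero_iff.1 h2)
  have hPlip : ∀ y ∈ Metric.ball y₁ ((s - r) * c / 2), ∀ y' ∈ Metric.ball y₁ ((s - r) * c / 2),
      ‖P y - P y'‖ ≤ 1 / (s - r) * ‖y - y'‖ := by
    intro y hy y' hy'
    have h1 := hexp _ _ _ _ (hP _ hy).1 (hP _ hy').1 (hP _ hy).2 (hP _ hy').2
    rw [sub_add_cancel, sub_add_cancel] at h1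
    rw [one_div, inv_mul_eq_div, le_div_iff₀ hκ]
    linarith
  have hP₁ : P y₁ = u₁ := hPeq _ _ hc₁ h₁ (Metric.mem_ball_self (by positivity))
  have hP₂ : P y₂ = u₂ := hPeq _ _ hu₂ h₂ (by
    rw [Metric.mem_ball, dist_eq_norm]; exact hy₂.trans (by linarith))
  have hscalar : ∀ w : X, (⟪w, P y₁⟫_ℝ - ⟪w, y₁⟫_ℝ / (2 * s)) - (⟪w, P y₂⟫_ℝ - ⟪w, y₂⟫_ℝ / (2 * s))
      ≤ ‖w‖ / (2 * s) * ‖y₂ - y₁‖ := by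
    intro w
    refine sub_le_mul_norm_of_proximal_subgradient_bound
      (g := fun y => ⟪w, P y⟫_ℝ - ⟪w, y⟫_ℝ / (2 * s)) (R := (s - r) * c / 3)
      (L := ‖w‖ * (1 / (s - r)) + ‖w‖ / (2 * s)) (by positivity) ?_ hy₂ ?_
    · intro y hy y' hy'
      have h1 : (⟪w, P y⟫_ℝ - ⟪w, y⟫_ℝ / (2 * s)) - (⟪w, P y'⟫_ℝ - ⟪w, y'⟫_ℝ / (2 * s)) =
          ⟪w, P y - P y'⟫_ℝ - ⟪w, y - y'⟫_ℝ / (2 * s) := by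
        rw [inner_sub_right, inner_sub_right]; ring
      rw [h1]
      refine (abs_sub _ _).trans ?_
      rw [abs_div, abs_of_pos (show 0 < 2 * s by positivity), add_mul]
      refine add_le_add ?_ ?_
      · rw [mul_assoc]
        exact (abs_real_inner_le_norm _ _).trans
          (mul_le_mul_of_nonneg_left (hPlip y (hsub hy) y' (hsub hy')) (norm_nonneg _))
      · rw [div_mul_eq_mul_div]
        exact div_le_div_of_nonneg_right (abs_real_inner_le_norm _ _) (by positivity)
    · intro y hy ζ C δ hδ h
      have hyb := hsub (Metric.ball_subset_closedBall hy)
      have huc : ‖P y - u₁‖ < c := by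
        have h1 := hPlip y hyb y₁ (Metric.mem_ball_self (by positivity))
        rw [hP₁, one_div, inv_mul_eq_div, le_div_iff₀ hκ] at h1
        rw [Metric.mem_ball, dist_eq_norm] at hyb
        by_contra! hcon
        nlinarith
      rw [Metric.mem_ball] at hyb
      have h1 := mul_norm_sq_le_inner_of_proximal_normal (ζ := ζ + (1 / (2 * s)) • w) (w := w)
        (C := C) (δ := min δ ((s - r) * c / 2 - dist y y₁)) hpsd hs (hP y hyb).2 huc
        (lt_min hδ (by linarith)) ?_
      · -- completing the square puts `ζ` in the ball of radius `‖w‖ / (2 * s)`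
        have h2 : s * ‖ζ + (1 / (2 * s)) • w‖ ^ 2 - ⟪w, ζ + (1 / (2 * s)) • w⟫_ℝ =
            s * (‖ζ‖ ^ 2 - (‖w‖ / (2 * s)) ^ 2) := by
          rw [norm_add_sq_real, inner_add_right, real_inner_smul_right, real_inner_smul_right,
            real_inner_self_eq_norm_sq, norm_smul, Real.norm_of_nonneg (by positivity),
            real_inner_comm ζ w]
          field_simp
          ring
        refine le_of_sq_le_sq ?_ (by positivity)
        nlinarith
      · intro u' v' hT' hu' hlt
        rw [sub_add_cancel] at hlt ⊢
        obtain ⟨hlt1, hlt2⟩ := lt_min_iff.1 hlt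
        have h2 := h _ hlt1
        rw [← dist_eq_norm] at hlt2
        have hmem : v' + s • u' ∈ Metric.ball y₁ ((s - r) * c / 2) := by
          rw [Metric.mem_ball]
          linarith [dist_triangle (v' + s • u') y y₁]
        rw [hPeq u' v' hu' hT' hmem] at h2
        rw [inner_add_left, real_inner_smul_left, inner_sub_right w u',
          inner_sub_right w (v' + s • u')]
        have h3 : 1 / (2 * s) * (⟪w, v' + s • u'⟫_ℝ - ⟪w, y⟫_ℝ) =
          ⟪w, v' + s • u'⟫_ℝ / (2 * s) - ⟪w, y⟫_ℝ / (2 * s) := by ring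
        rw [h3]
        linarith
  -- Testing with the increment `Q` of `P - I / (2 s)` itself shows that this map is
  -- `1 / (2 s)`-Lipschitz from `y₁`.
  set Q : X := (u₁ - u₂) - (1 / (2 * s)) • (y₁ - y₂) with hQ
  have hQle : ‖Q‖ ≤ 1 / (2 * s) * ‖y₁ - y₂‖ := by
    have h1 := hscalar Q
    have h2 : (⟪Q, P y₁⟫_ℝ - ⟪Q, y₁⟫_ℝ / (2 * s)) - (⟪Q, P y₂⟫_ℝ - ⟪Q, y₂⟫_ℝ / (2 * s)) =
        ‖Q‖ ^ 2 := by
      rw [← real_inner_self_eq_norm_sq]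
      conv_rhs => rw [hQ]
      rw [← hQ, hP₁, hP₂, inner_sub_right, inner_smul_right, inner_sub_right, inner_sub_right]
      ring
    rw [h2, norm_sub_rev y₂ y₁] at h1
    rcases (norm_nonneg Q).eq_or_lt with h0 | h0
    · rw [← h0]; positivity
    · refine le_of_mul_le_mul_left ?_ h0
      calc ‖Q‖ * ‖Q‖ = ‖Q‖ ^ 2 := (sq _).symm
        _ ≤ _ := h1
        _ = _ := by ring
  have h3 := pow_le_pow_left₀ (norm_nonneg _) hQle 2
  rw [hQ, norm_sub_sq_real, norm_smul, Real.norm_of_nonneg (by positivity),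
    real_inner_smul_right] at h3
  have h4 : y₁ - y₂ = (v₁ - v₂) + s • (u₁ - u₂) := by rw [hy₁, hy₂def]; module
  rw [mul_pow] at h3
  have h5 : ⟪u₁ - u₂, y₁ - y₂⟫_ℝ = ⟪v₁ - v₂, u₁ - u₂⟫_ℝ + s * ‖u₁ - u₂‖ ^ 2 := by
    rw [h4, inner_add_right, real_inner_smul_right, real_inner_self_eq_norm_sq, real_inner_comm]
  rw [h5] at h3
  have h6 : 2 * (1 / (2 * s) * (⟪v₁ - v₂, u₁ - u₂⟫_ℝ + s * ‖u₁ - u₂‖ ^ 2)) =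
      ⟪v₁ - v₂, u₁ - u₂⟫_ℝ / s + ‖u₁ - u₂‖ ^ 2 := by field_simp
  rw [h6] at h3
  have h7 : 0 ≤ ⟪v₁ - v₂, u₁ - u₂⟫_ℝ / s := by linarith
  have h8 := mul_nonneg h7 hs.le
  rw [div_mul_cancel₀ _ hs.ne'] at h8
  rwa [← neg_sub v₁ v₂, ← neg_sub u₁ u₂, inner_neg_neg]

/-- Monotonicity of `T` for pairs of graph points with close first components, whatever the second
components are. -/
theorem inner_nonneg_of_hypomonotone_near (hT : IsClosed (VarAnal.gph T))
    (hpsd : VarAnal.MixedCoderivativePSD T) (hr : 0 < r) (h₁ : v₁ ∈ T u₁)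
    (hhyp : ∀ u v u' v', ‖u - u₁‖ ≤ c → ‖u' - u₁‖ ≤ c → v ∈ T u → v' ∈ T u' →
      -r * ‖u - u'‖ ^ 2 ≤ ⟪v - v', u - u'⟫_ℝ)
    {u₂ v₂ : X} (h₂ : v₂ ∈ T u₂) (hu₂ : 3 * ‖u₂ - u₁‖ < c) :
    0 ≤ ⟪v₂ - v₁, u₂ - u₁⟫_ℝ := by
  have h0 := norm_nonneg (u₂ - u₁)
  have hgap : 0 < c - 3 * ‖u₂ - u₁‖ := by linarith
  -- the radius grows faster in `s` than the distance of the shifted points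
  set s := (3 * ‖v₂ - v₁‖ + r * c) / (c - 3 * ‖u₂ - u₁‖) + r + 1 with hs
  have hc : 0 < c := by linarith
  have h1 : 0 ≤ (3 * ‖v₂ - v₁‖ + r * c) / (c - 3 * ‖u₂ - u₁‖) := by positivity
  have h2 : 3 * ‖v₂ - v₁‖ + r * c < s * (c - 3 * ‖u₂ - u₁‖) := by
    rw [hs, add_assoc, add_mul, div_mul_cancel₀ _ hgap.ne']
    nlinarith
  refine inner_nonneg_of_shifted_near (s := s) hT hpsd (by linarith) (by linarith) hc h₁ hhyp h₂
    (by linarith) ?_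
  have heq : (v₂ + s • u₂) - (v₁ + s • u₁) = (v₂ - v₁) + s • (u₂ - u₁) := by module
  have h3 := norm_add_le (v₂ - v₁) (s • (u₂ - u₁))
  rw [norm_smul, Real.norm_of_nonneg (show 0 ≤ s by linarith), ← heq] at h3
  nlinarith

end

/-! ### Monotonicity and maximality from the coderivative condition -/

section
variable {X : Type*} [NormedAddCommGroup X] [InnerProductSpace ℝ X] {T : X → Set X}

theorem isMaximalMonotone_of_isMonotone [CompleteSpace X] (hproper : (VarAnal.dom T).Nonempty)
    (hT : IsClosed (VarAnal.gph T)) (hmono : VarAnal.IsMonotone T)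
    (hpsd : VarAnal.MixedCoderivativePSD T) : VarAnal.IsMaximalMonotone T := by
  refine ⟨hmono, fun S hS hTS => hTS.antisymm ?_⟩
  rintro ⟨u, v⟩ huv
  obtain ⟨u₁, v₁, h₁⟩ := hproper
  have hfull := ball_subset_shifted_range (s := 1) (r := 0)
    (c := 2 * ‖(v + u) - (v₁ + u₁)‖ + 1) hT hpsd one_pos one_pos (by positivity) h₁
    (fun u v u' v' _ _ hv hv' => by simpa using hmono (u, v) hv (u', v') hv')
  have hmem : v + u ∈ Metric.ball (v₁ + (1 : ℝ) • u₁)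
      ((1 - 0) * (2 * ‖(v + u) - (v₁ + u₁)‖ + 1) / 2) := by
    rw [one_smul, Metric.mem_ball, dist_eq_norm]; linarith
  obtain ⟨u', -, hu'⟩ := hfull hmem
  rw [one_smul] at hu'
  have h1 := hS (u, v) huv (u', v + u - u') (hTS hu')
  have h2 : v - (v + u - u') = -(u - u') := by abel
  simp only [h2, inner_neg_left, real_inner_self_eq_norm_sq] at h1
  have h3 : ‖u - u'‖ ^ 2 ≤ 0 := by linarith
  have h4 : u = u' := by
    simpa [sub_eq_zero] using h3
  rw [← h4, add_sub_cancel_right] at hu'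
  exact hu'

theorem isMonotone_of_isHypomonotone [CompleteSpace X] (hT : IsClosed (VarAnal.gph T))
    (hhyp : VarAnal.IsHypomonotone T) (hpsd : VarAnal.MixedCoderivativePSD T) :
    VarAnal.IsMonotone T := by
  obtain ⟨r, hr, h⟩ := hhyp
  rintro ⟨u₂, v₂⟩ h₂ ⟨u₁, v₁⟩ h₁
  exact inner_nonneg_of_hypomonotone_near (c := 3 * ‖u₂ - u₁‖ + 1) hT hpsd hr h₁
    (fun u v u' v' _ _ hv hv' => h (u, v) hv (u', v') hv') h₂ (lt_add_one _)

theorem exists_ball_monotone_of_isSemilocallyHypomonotoneAt [CompleteSpace X]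
    (hT : IsClosed (VarAnal.gph T)) (hpsd : VarAnal.MixedCoderivativePSD T) {x : X}
    (hhyp : VarAnal.IsSemilocallyHypomonotoneAt T x) :
    ∃ ε > 0, ∀ u₁ v₁ u₂ v₂, ‖u₁ - x‖ < ε → ‖u₂ - x‖ < ε → v₁ ∈ T u₁ → v₂ ∈ T u₂ →
      0 ≤ ⟪v₂ - v₁, u₂ - u₁⟫_ℝ := by
  obtain ⟨U, hU, r, hr, h⟩ := hhyp
  obtain ⟨δ, hδ, hδU⟩ := Metric.mem_nhds_iff.1 hU
  refine ⟨δ / 8, by positivity, fun u₁ v₁ u₂ v₂ hu₁ hu₂ h₁ h₂ => ?_⟩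
  have hball : ∀ u, ‖u - u₁‖ ≤ 3 * δ / 4 → u ∈ U := by
    intro u hu
    refine hδU ?_
    rw [Metric.mem_ball, dist_eq_norm]
    have := norm_add_le (u - u₁) (u₁ - x)
    rw [sub_add_sub_cancel] at this
    linarith
  refine inner_nonneg_of_hypomonotone_near (c := 3 * δ / 4) hT hpsd hr h₁
    (fun u v u' v' hu hu' hv hv' => h (u, v) ⟨hv, hball u hu, trivial⟩ (u', v')
      ⟨hv', hball u' hu', trivial⟩) h₂ ?_
  have := norm_sub_le (u₂ - x) (u₁ - x)
  rw [sub_sub_sub_cancel_right] at this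
  linarith

/-- Local monotonicity spreads along a segment in the domain: subdivide it, with a selection of `T`
at the nodes, and add up the inequalities between neighbouring nodes. -/
theorem isMonotone_of_locally_monotone (hconv : Convex ℝ (VarAnal.dom T))
    (hloc : ∀ x ∈ VarAnal.dom T, ∃ ε > 0, ∀ u₁ v₁ u₂ v₂, ‖u₁ - x‖ < ε → ‖u₂ - x‖ < ε →
      v₁ ∈ T u₁ → v₂ ∈ T u₂ → 0 ≤ ⟪v₂ - v₁, u₂ - u₁⟫_ℝ) : VarAnal.IsMonotone T := by
  rintro ⟨u₂, v₂⟩ h₂ ⟨u₁, v₁⟩ h₁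
  change v₂ ∈ T u₂ at h₂
  change v₁ ∈ T u₁ at h₁
  simp only
  let γ : ℝ → X := fun t => u₁ + t • (u₂ - u₁)
  have hγc : Continuous γ := by fun_prop
  have hγdom : ∀ t ∈ Set.Icc (0 : ℝ) 1, γ t ∈ VarAnal.dom T := fun t ht =>
    hconv.add_smul_sub_mem ⟨v₁, h₁⟩ ⟨v₂, h₂⟩ ht
  -- a selection of `T` along the segment, prescribed at the end points
  obtain ⟨V, hV, hV0, hV1⟩ : ∃ V : ℝ → X, (∀ t ∈ Set.Icc (0 : ℝ) 1, V t ∈ T (γ t)) ∧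
      V 0 = v₁ ∧ V 1 = v₂ := by
    have : ∀ t : ℝ, ∃ x : X, (t ∈ Set.Icc (0 : ℝ) 1 → x ∈ T (γ t)) ∧ (t = 0 → x = v₁) ∧
        (t = 1 → x = v₂) := by
      intro t
      by_cases h0 : t = 0
      · exact ⟨v₁, fun _ => by simpa [γ, h0] using h₁, fun _ => rfl, fun h => by simp [h0] at h⟩
      by_cases h1 : t = 1
      · exact ⟨v₂, fun _ => by simpa [γ, h1] using h₂, fun h => absurd h h0, fun _ => rfl⟩
      by_cases ht : t ∈ Set.Icc (0 : ℝ) 1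
      · obtain ⟨x, hx⟩ := hγdom t ht
        exact ⟨x, fun _ => hx, fun h => absurd h h0, fun h => absurd h h1⟩
      · exact ⟨0, fun h => absurd h ht, fun h => absurd h h0, fun h => absurd h h1⟩
    choose V hV using this
    exact ⟨V, fun t => (hV t).1, (hV 0).2.1 rfl, (hV 1).2.2 rfl⟩
  choose! ε hε hmono using hloc
  obtain ⟨δ, hδ, hleb⟩ := lebesgue_number_lemma_of_metric (isCompact_Icc (a := (0 : ℝ)) (b := 1))
    (c := fun i : Set.Icc (0 : ℝ) 1 => γ ⁻¹' Metric.ball (γ i) (ε (γ i)))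
    (fun i => Metric.isOpen_ball.preimage hγc) (fun t ht => Set.mem_iUnion.2 ⟨⟨t, ht⟩,
      Metric.mem_ball_self (hε _ (hγdom t ht))⟩)
  have hstep : ∀ t ∈ Set.Icc (0 : ℝ) 1, ∀ t' ∈ Set.Icc (0 : ℝ) 1, t < t' → t' - t < δ →
      ⟪V t, u₂ - u₁⟫_ℝ ≤ ⟪V t', u₂ - u₁⟫_ℝ := by
    intro t ht t' ht' hlt hd
    obtain ⟨i, hi⟩ := hleb t ht
    have hm := hi (Metric.mem_ball_self hδ)
    have hm' : t' ∈ _ := hi (by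
      rw [Metric.mem_ball, Real.dist_eq, abs_of_pos (sub_pos.2 hlt)]; exact hd)
    rw [Set.mem_preimage, Metric.mem_ball, dist_eq_norm] at hm hm'
    have h := hmono _ (hγdom i i.2) _ _ _ _ hm hm' (hV t ht) (hV t' ht')
    have heq : γ t' - γ t = (t' - t) • (u₂ - u₁) := by simp only [γ]; module
    rw [heq, real_inner_smul_right, inner_sub_left] at h
    have := nonneg_of_mul_nonneg_right h (sub_pos.2 hlt)
    linarith
  obtain ⟨n, hn⟩ := exists_nat_one_div_lt hδ
  have hind : ∀ k : ℕ, k ≤ n + 1 → ⟪V 0, u₂ - u₁⟫_ℝ ≤ ⟪V (k / (n + 1)), u₂ - u₁⟫_ℝ := by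
    intro k
    induction k with
    | zero => intro _; simp
    | succ k ih =>
      intro hk
      have hk' : (k : ℝ) + 1 ≤ n + 1 := by exact_mod_cast hk
      have hdiff : ((k + 1 : ℕ) : ℝ) / (n + 1) - k / (n + 1) = 1 / ((n : ℝ) + 1) := by
        push_cast; ring
      have hpos : 0 < 1 / ((n : ℝ) + 1) := by positivity
      have hle : ((k + 1 : ℕ) : ℝ) / (n + 1) ≤ 1 := by
        rw [div_le_one (by positivity)]; push_cast; exact hk'
      refine (ih (by omega)).trans (hstep _ ⟨by positivity, by linarith⟩ _
        ⟨by positivity, hle⟩ (by linarith) (by linarith))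
  have hfin := hind (n + 1) le_rfl
  rw [show (((n + 1 : ℕ) : ℝ) / (n + 1)) = 1 by push_cast; field_simp, hV0, hV1] at hfin
  rw [inner_sub_left]
  linarith

end

/-! ### Minty's theorem and the coderivative of a maximal monotone map -/

section
variable {X : Type*} [NormedAddCommGroup X] [InnerProductSpace ℝ X] {T : X → Set X}

/-- For a finite monotone set `G` some pair `(x, -x)` is monotonically related to all of `G`. This is a
minimax argument: the dual problem is to minimize `‖v - u‖ ^ 2 / 4 + c` over the convex hull of the points
`(u, v, ⟪v, u⟫)`, and `x` is read off from a minimizer. -/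
theorem exists_monotone_extension_of_finite {G : Set (X × X)} (hG : G.Finite)
    (hmono : ∀ p ∈ G, ∀ q ∈ G, 0 ≤ ⟪p.2 - q.2, p.1 - q.1⟫_ℝ) :
    ∃ x : X, ∀ p ∈ G, 0 ≤ ⟪p.2 + x, p.1 - x⟫_ℝ := by
  rcases G.eq_empty_or_nonempty with rfl | hne
  · exact ⟨0, by simp⟩
  let f : X × X → (X × X) × ℝ := fun p => (p, ⟪p.2, p.1⟫_ℝ)
  set K := convexHull ℝ (f '' G) with hK
  have hKcomp : IsCompact K := (hG.image f).isCompact_convexHull ℝ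
  have hKne : K.Nonempty := (hne.image f).convexHull
  have hfK : ∀ p ∈ G, f p ∈ K := fun p hp => subset_convexHull ℝ _ (Set.mem_image_of_mem f hp)
  -- Monotonicity of `G` says that the symmetric expression below is nonnegative at pairs of
  -- generators. Being affine in each argument, it is nonnegative on all pairs in the hull, and on the
  -- diagonal this is `c ≥ ⟪v, u⟫`.
  have hhalf : ∀ k : (X × X) × ℝ, Convex ℝ {k' : (X × X) × ℝ |
      0 ≤ k.2 + k'.2 - ⟪k.1.2, k'.1.1⟫_ℝ - ⟪k'.1.2, k.1.1⟫_ℝ} := by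
    intro k k₁ h₁ k₂ h₂ a b ha hb hab
    simp only [Set.mem_ofPred_eq] at h₁ h₂ ⊢
    simp only [Prod.snd_add, Prod.fst_add, Prod.smul_snd, Prod.smul_fst, inner_add_left,
      inner_add_right, real_inner_smul_left, real_inner_smul_right, smul_eq_mul]
    have e1 := mul_nonneg ha h₁
    have e2 := mul_nonneg hb h₂
    have e3 : k.2 = a * k.2 + b * k.2 := by rw [← add_mul, hab, one_mul]
    rw [e3]
    linarith
  have hform : ∀ k ∈ K, ⟪k.1.2, k.1.1⟫_ℝ ≤ k.2 := by
    have h1 : ∀ p ∈ G, ∀ k ∈ K, 0 ≤ (f p).2 + k.2 - ⟪(f p).1.2, k.1.1⟫_ℝ - ⟪k.1.2, (f p).1.1⟫_ℝ := by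
      intro p hp k hk
      refine convexHull_min ?_ (hhalf (f p)) hk
      rintro _ ⟨q, hq, rfl⟩
      have := hmono p hp q hq
      rw [inner_sub_left, inner_sub_right, inner_sub_right] at this
      simp only [Set.mem_ofPred_eq, f]
      linarith
    intro k hk
    have h2 : k ∈ {k' : (X × X) × ℝ | 0 ≤ k.2 + k'.2 - ⟪k.1.2, k'.1.1⟫_ℝ - ⟪k'.1.2, k.1.1⟫_ℝ} := by
      refine convexHull_min ?_ (hhalf k) hk
      rintro _ ⟨q, hq, rfl⟩
      have := h1 q hq k hk
      simp only [Set.mem_ofPred_eq]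
      linarith
    simp only [Set.mem_ofPred_eq] at h2
    linarith
  obtain ⟨k, hkK, hkmin⟩ := hKcomp.exists_isMinOn hKne
    (f := fun k : (X × X) × ℝ => ‖k.1.2 - k.1.1‖ ^ 2 / 4 + k.2) (by fun_prop)
  set W := k.1.2 - k.1.1 with hW
  have hval : 0 ≤ ‖W‖ ^ 2 / 4 + k.2 := by
    have h1 := hform k hkK
    rw [hW, norm_sub_sq_real]
    have h2 := norm_add_sq_real k.1.2 k.1.1
    nlinarith [sq_nonneg (‖k.1.2 + k.1.1‖)]
  refine ⟨-(1 / 2 : ℝ) • W, fun p hp => ?_⟩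
  -- first-order optimality in the direction of the generator `f p`
  have hopt : 0 ≤ ⟪W, (p.2 - p.1) - W⟫_ℝ / 2 + (⟪p.2, p.1⟫_ℝ - k.2) := by
    set w := (p.2 - p.1) - W with hw
    have hineq : ∀ t : ℝ, 0 < t → t ≤ 1 →
        0 ≤ (⟪W, w⟫_ℝ / 2 + (⟪p.2, p.1⟫_ℝ - k.2)) + t * (‖w‖ ^ 2 / 4) := by
      intro t ht ht1
      have hmem : (1 - t) • k + t • f p ∈ K :=
        (convex_convexHull ℝ _) hkK (hfK p hp) (by linarith) ht.le (by ring)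
      have h1 := isMinOn_iff.1 hkmin _ hmem
      have h2 : ((1 - t) • k + t • f p).1.2 - ((1 - t) • k + t • f p).1.1 = W + t • w := by
        simp only [f, Prod.snd_add, Prod.fst_add, Prod.smul_snd, Prod.smul_fst, hw, hW]
        module
      have h3 : ((1 - t) • k + t • f p).2 = k.2 + t * (⟪p.2, p.1⟫_ℝ - k.2) := by
        simp only [f, Prod.snd_add, Prod.smul_snd, smul_eq_mul]
        ring
      simp only [h2, h3, ← hW] at h1
      rw [norm_add_sq_real, real_inner_smul_right, norm_smul, mul_pow, Real.norm_eq_abs,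
        sq_abs] at h1
      have h4 : 0 ≤ t * ((⟪W, w⟫_ℝ / 2 + (⟪p.2, p.1⟫_ℝ - k.2)) + t * (‖w‖ ^ 2 / 4)) := by
        linarith
      exact nonneg_of_mul_nonneg_right h4 ht
    have hlim : Tendsto (fun t : ℝ => (⟪W, w⟫_ℝ / 2 + (⟪p.2, p.1⟫_ℝ - k.2)) + t * (‖w‖ ^ 2 / 4))
        (𝓝[>] 0) (𝓝 ((⟪W, w⟫_ℝ / 2 + (⟪p.2, p.1⟫_ℝ - k.2)) + 0 * (‖w‖ ^ 2 / 4))) :=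
      (Continuous.tendsto (by fun_prop) 0).mono_left nhdsWithin_le_nhds
    rw [zero_mul, add_zero] at hlim
    refine ge_of_tendsto hlim ?_
    filter_upwards [Ioc_mem_nhdsGT (one_pos (α := ℝ))] with t ht using hineq t ht.1 ht.2
  have h1 : ⟪p.2 + -(1 / 2 : ℝ) • W, p.1 - -(1 / 2 : ℝ) • W⟫_ℝ =
      ⟪p.2, p.1⟫_ℝ + ⟪W, p.2 - p.1⟫_ℝ / 2 - ‖W‖ ^ 2 / 4 := by
    rw [← real_inner_self_eq_norm_sq]
    simp only [inner_add_left, inner_sub_right, real_inner_smul_left, real_inner_smul_right,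
      real_inner_comm W]
    ring
  rw [h1]
  rw [inner_sub_right, real_inner_self_eq_norm_sq] at hopt
  linarith

/-- The points `x` for which `(x, -x)` is monotonically related to `(u, v)` form a closed ball. -/
theorem inner_add_sub_nonneg_iff {u v x : X} :
    0 ≤ ⟪v + x, u - x⟫_ℝ ↔ ‖x - (1 / 2 : ℝ) • (u - v)‖ ≤ ‖u + v‖ / 2 := by
  have h : ‖x - (1 / 2 : ℝ) • (u - v)‖ ^ 2 + ⟪v + x, u - x⟫_ℝ = (‖u + v‖ / 2) ^ 2 := by
    rw [div_pow, ← real_inner_self_eq_norm_sq, ← real_inner_self_eq_norm_sq]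
    simp only [inner_add_left, inner_add_right, inner_sub_left, inner_sub_right,
      real_inner_smul_left, real_inner_smul_right, real_inner_comm x, real_inner_comm u v]
    ring
  rw [← sq_le_sq₀ (norm_nonneg _) (by positivity)]
  constructor <;> intro h' <;> linarith

theorem tendsto_inner_of_tendsto_toWeakSpace {y : ℕ → X} {z : X}
    (h : Tendsto (fun k => toWeakSpace ℝ X (y k)) atTop (𝓝 (toWeakSpace ℝ X z))) (x : X) :
    Tendsto (fun k => ⟪y k, x⟫_ℝ) atTop (𝓝 ⟪z, x⟫_ℝ) := by
  have := ((WeakBilin.eval_continuous (topDualPairing ℝ X).flip (innerSL ℝ x)).tendsto _).comp h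
  simp only [real_inner_comm x]
  exact this

variable [CompleteSpace X]

/-- Every monotone set is monotonically related to some pair `(x, -x)`, by weak compactness of balls
and the finite case. -/
theorem exists_monotone_extension {G : Set (X × X)}
    (hmono : ∀ p ∈ G, ∀ q ∈ G, 0 ≤ ⟪p.2 - q.2, p.1 - q.1⟫_ℝ) :
    ∃ x : X, ∀ p ∈ G, 0 ≤ ⟪p.2 + x, p.1 - x⟫_ℝ := by
  classical
  rcases G.eq_empty_or_nonempty with rfl | ⟨p₀, hp₀⟩
  · exact ⟨0, by simp⟩
  -- The solution sets for single pairs, carried to the dual space, where closed balls are weak-*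
  -- compact.
  let B : X × X → Set (WeakDual ℝ X) := fun p => WeakDual.toStrongDual ⁻¹'
    Metric.closedBall (InnerProductSpace.toDual ℝ X ((1 / 2 : ℝ) • (p.1 - p.2))) (‖p.1 + p.2‖ / 2)
  have hB : ∀ (p : X × X) (x : X),
      (InnerProductSpace.toDual ℝ X x).toWeakDual ∈ B p ↔ 0 ≤ ⟪p.2 + x, p.1 - x⟫_ℝ := by
    intro p x
    rw [inner_add_sub_nonneg_iff, ← dist_eq_norm, ← (InnerProductSpace.toDual ℝ X).dist_map]
    rfl
  have hcomp : ∀ p, IsCompact (B p) := fun p => WeakDual.isCompact_closedBall _ _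
  obtain ⟨φ, -, hφ⟩ := (hcomp p₀).inter_iInter_nonempty (fun p : G => B p)
    (fun p => (hcomp p).isClosed) (fun F => by
      obtain ⟨x, hx⟩ := exists_monotone_extension_of_finite
        (G := insert p₀ (Subtype.val '' (F : Set G))) ((F.finite_toSet.image _).insert _) (by
          have hsub : insert p₀ (Subtype.val '' (F : Set G)) ⊆ G := by
            rintro p (rfl | ⟨q, -, rfl⟩)
            · exact hp₀
            · exact q.2
          exact fun p hp q hq => hmono p (hsub hp) q (hsub hq))
      refine ⟨(InnerProductSpace.toDual ℝ X x).toWeakDual, (hB _ _).2 (hx _ (Set.mem_insert _ _)),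
        Set.mem_iInter₂.2 fun p hp => (hB _ _).2 (hx _ (Set.mem_insert_of_mem _ ⟨p, hp, rfl⟩))⟩)
  rw [Set.mem_iInter] at hφ
  refine ⟨(InnerProductSpace.toDual ℝ X).symm φ.toStrongDual, fun p hp => (hB p _).1 ?_⟩
  rw [LinearIsometryEquiv.apply_symm_apply]
  exact hφ ⟨p, hp⟩

/-- Minty's theorem: `T + I` is onto if `T` is maximal monotone. -/
theorem exists_mem_sub_of_isMaximalMonotone (hT : VarAnal.IsMaximalMonotone T) (y : X) :
    ∃ x, y - x ∈ T x := by
  obtain ⟨x, hx⟩ := exists_monotone_extension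
    (G := {p : X × X | p.2 + y ∈ T p.1}) (fun p hp q hq => by
      simpa using hT.1 (p.1, p.2 + y) hp (q.1, q.2 + y) hq)
  have hx' : ∀ u v, v ∈ T u → 0 ≤ ⟪v - (y - x), u - x⟫_ℝ := by
    intro u v huv
    have := hx (u, v - y) (by simpa using huv)
    rwa [sub_sub_eq_add_sub, add_sub_right_comm]
  refine ⟨x, ?_⟩
  let S : X → Set X := fun u => {v | v ∈ T u ∨ (u = x ∧ v = y - x)}
  have hS : VarAnal.IsMonotone S := by
    rintro ⟨u, v⟩ (h | ⟨h₁, h₂⟩) ⟨u', v'⟩ (h' | ⟨h₁', h₂'⟩) <;> simp only at *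
    · exact hT.1 (u, v) h (u', v') h'
    · rw [h₁', h₂']
      exact hx' u v h
    · rw [h₁, h₂, ← inner_neg_neg, neg_sub, neg_sub]
      exact hx' u' v' h'
    · simp [h₁, h₂, h₁', h₂']
  have heq := hT.2 S hS (fun p hp => Or.inl hp)
  have : (x, y - x) ∈ VarAnal.gph S := Or.inr ⟨rfl, rfl⟩
  rw [← heq] at this
  exact this

theorem inner_nonneg_of_mem_regularCoderivative (hT : VarAnal.IsMaximalMonotone T) {u v w z : X}
    (hz : z ∈ VarAnal.regularCoderivative T u v w) : 0 ≤ ⟪z, w⟫_ℝ := by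
  obtain ⟨huv, hlim⟩ := mem_regularCoderivative_iff.1 hz
  rcases eq_or_ne z w with rfl | hne
  · exact real_inner_self_nonneg
  set h := z - w with hh
  have hpos : 0 < ‖h‖ := norm_pos_iff.2 (sub_ne_zero.2 hne)
  have key : ∀ ε > 0, ‖h‖ ≤ ‖z + w‖ + ε * 4 := by
    intro ε hε
    obtain ⟨δ, hδ, hδle⟩ := hlim ε hε
    set t := δ / (2 * ‖h‖) with ht
    have htpos : 0 < t := by positivity
    have hth : t * ‖h‖ = δ / 2 := by rw [ht]; field_simp
    obtain ⟨u', hu'⟩ := exists_mem_sub_of_isMaximalMonotone hT (u + v + t • h)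
    set d := u' - u with hd
    have hdv : u + v + t • h - u' - v = t • h - d := by rw [hd]; abel
    have hmono := hT.1 (u', u + v + t • h - u') hu' (u, v) huv
    simp only [hdv, ← hd] at hmono
    rw [inner_sub_left, real_inner_self_eq_norm_sq] at hmono
    have hnt : ‖t • h‖ = t * ‖h‖ := by rw [norm_smul, Real.norm_of_nonneg htpos.le]
    -- both increments lie in the ball with diameter `[0, t • h]`
    have hball : ‖d - (1 / 2 : ℝ) • t • h‖ ≤ t * ‖h‖ / 2 := by
      refine le_of_sq_le_sq ?_ (by positivity)
      rw [norm_sub_sq_real, real_inner_smul_right, norm_smul, hnt, real_inner_comm]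
      norm_num
      nlinarith
    have hdle : ‖d‖ ≤ t * ‖h‖ := by
      have h1 := norm_add_le (d - (1 / 2 : ℝ) • t • h) ((1 / 2 : ℝ) • t • h)
      rw [sub_add_cancel, norm_smul, hnt] at h1
      norm_num at h1
      linarith
    have hdle' : ‖t • h - d‖ ≤ t * ‖h‖ := by
      have h1 := norm_sub_le ((1 / 2 : ℝ) • t • h) (d - (1 / 2 : ℝ) • t • h)
      have h2 : (1 / 2 : ℝ) • t • h - (d - (1 / 2 : ℝ) • t • h) = t • h - d := by module
      rw [h2, norm_smul, hnt] at h1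
      norm_num at h1
      linarith
    have h1 := hδle u' _ hu' (by rw [← hd]; linarith) (by rw [hdv]; linarith)
    rw [hdv, ← hd] at h1
    have h2 := (abs_le.1 (abs_real_inner_le_norm (z + w) (d - (1 / 2 : ℝ) • t • h))).1
    have h3 := mul_le_mul_of_nonneg_left hball (norm_nonneg (z + w))
    have h4 : ε * (‖d‖ + ‖t • h - d‖) ≤ ε * (2 * (t * ‖h‖)) :=
      mul_le_mul_of_nonneg_left (by linarith) hε.le
    have h5 : ⟪z, d⟫_ℝ - ⟪w, t • h - d⟫_ℝ - ⟪z + w, d - (1 / 2 : ℝ) • t • h⟫_ℝ =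
        t / 2 * ‖h‖ ^ 2 := by
      have : ‖h‖ ^ 2 = ⟪z, h⟫_ℝ - ⟪w, h⟫_ℝ := by
        rw [← real_inner_self_eq_norm_sq, ← inner_sub_left]
      rw [this]
      simp only [inner_add_left, inner_sub_right, real_inner_smul_right]
      ring
    have h6 : (t / 2 * ‖h‖) * ‖h‖ ≤ (t / 2 * ‖h‖) * (‖z + w‖ + ε * 4) := by nlinarith
    exact le_of_mul_le_mul_left h6 (by positivity)
  have hle : ‖h‖ ≤ ‖z + w‖ := by
    refine le_of_forall_pos_le_add fun ε hε => ?_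
    have := key (ε / 4) (by positivity)
    linarith
  have h1 := pow_le_pow_left₀ (norm_nonneg _) hle 2
  rw [hh, norm_sub_sq_real, norm_add_sq_real] at h1
  linarith

/-- The inequality for regular coderivatives passes to mixed limits: `⟪z_k, w_k⟫` converges, as the
weakly convergent sequence `z_k` is bounded. -/
theorem mixedCoderivativePSD_of_isMaximalMonotone (hT : VarAnal.IsMaximalMonotone T) :
    VarAnal.MixedCoderivativePSD T := by
  rintro u v - w z ⟨p, y, hp, hy, hmem⟩
  have hweak := tendsto_inner_of_tendsto_toWeakSpace hy
  have hw : Tendsto (fun k => (p k).2) atTop (𝓝 w) := (continuous_snd.tendsto _).comp hp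
  obtain ⟨C, hC⟩ := banach_steinhaus (g := fun k => innerSL ℝ (y k)) (fun x => by
    obtain ⟨C, hC⟩ := (hweak x).norm.bddAbove_range
    exact ⟨C, fun k => hC ⟨k, rfl⟩⟩)
  have hlim : Tendsto (fun k => ⟪y k, (p k).2⟫_ℝ) atTop (𝓝 ⟪z, w⟫_ℝ) := by
    have h0 : Tendsto (fun k => ⟪y k, (p k).2 - w⟫_ℝ) atTop (𝓝 0) := by
      refine squeeze_zero_norm (a := fun k => C * ‖(p k).2 - w‖) (fun k => ?_) ?_
      · have h1 := hC k
        rw [innerSL_apply_norm] at h1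
        exact (norm_inner_le_norm _ _).trans (mul_le_mul_of_nonneg_right h1 (norm_nonneg _))
      · have := (tendsto_iff_norm_sub_tendsto_zero.1 hw).const_mul C
        rwa [mul_zero] at this
    have h1 := h0.add (hweak w)
    rw [zero_add] at h1
    refine h1.congr fun k => ?_
    rw [← inner_add_right, sub_add_cancel]
  exact ge_of_tendsto' hlim fun k => inner_nonneg_of_mem_regularCoderivative hT (hmem k)

end

theorem theorem3p7 {X : Type*} [NormedAddCommGroup X] [InnerProductSpace ℝ X] [CompleteSpace X]
    (T : X → Set X) (hproper : (VarAnal.dom T).Nonempty) (hclosed : IsClosed (VarAnal.gph T)) :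
    (VarAnal.IsMaximalMonotone T ↔
      VarAnal.IsHypomonotone T ∧ VarAnal.MixedCoderivativePSD T) ∧
    (Convex ℝ (VarAnal.dom T) →
      (VarAnal.IsMaximalMonotone T ↔
        VarAnal.IsSemilocallyHypomonotone T ∧ VarAnal.MixedCoderivativePSD T)) := by
  have hhyp : VarAnal.IsMaximalMonotone T → ∀ p₁ ∈ VarAnal.gph T, ∀ p₂ ∈ VarAnal.gph T,
      -1 * ‖p₁.1 - p₂.1‖ ^ 2 ≤ ⟪p₁.2 - p₂.2, p₁.1 - p₂.1⟫_ℝ := fun hT p₁ h₁ p₂ h₂ =>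
    le_trans (by nlinarith [sq_nonneg ‖p₁.1 - p₂.1‖]) (hT.1 p₁ h₁ p₂ h₂)
  refine ⟨⟨fun hT => ⟨⟨1, one_pos, hhyp hT⟩, mixedCoderivativePSD_of_isMaximalMonotone hT⟩,
    fun h => isMaximalMonotone_of_isMonotone hproper hclosed
      (isMonotone_of_isHypomonotone hclosed h.1 h.2) h.2⟩, fun hconv =>
    ⟨fun hT => ⟨fun x _ => ⟨Set.univ, univ_mem, 1, one_pos,
      fun p₁ h₁ p₂ h₂ => hhyp hT p₁ h₁.1 p₂ h₂.1⟩, mixedCoderivativePSD_of_isMaximalMonotone hT⟩,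
    fun h => ?_⟩⟩
  refine isMaximalMonotone_of_isMonotone hproper hclosed ?_ h.2
  exact isMonotone_of_locally_monotone hconv fun x hx =>
    exists_ball_monotone_of_isSemilocallyHypomonotoneAt hclosed h.2 (h.1 x hx)
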